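/- Let $\Sigma\subset\mathbb{C}$ be a compact set with connected complement, let $\mu$ be a Borel probability measure supported on $\Sigma$, and let $f$ be analytic on an open set $V\supseteq\Sigma$. Put $P(\mu;z)=\int-\log|z-\zeta|\,d\mu(\zeta)\in(-\infty,+\infty]$, $\rho_\mu(K)=\sup_{z\in K}e^{-P(\mu;z)}$, $r_0=\inf_{z\in\Sigma}e^{-P(\mu;z)}$ and $E_\mu(r)=\{z\in\mathbb{C}:e^{-P(\mu;z)}<r\}$ for $0\le r\le\infty$. For an open set $U\subseteq\mathbb C$ we say that $f$ admits meromorphic continuation with at most $m$ poles to $U$ if there is a meromorphic function $F$ on $U$ with at most $m$ poles, counting multiplicities, that coincides with $f$ in a neighbourhood of every point of $U\cap\operatorname{supp}\mu$. Let $R_{\mu,m}\in[r_0,\infty]$ be the supremum (taken in $[r_0,\infty]$) of the numbers $r>r_0$ such that $f$ admits meromorphic continuation with at most $m$ poles to $E_\mu(r)$. Let $w_n(z)=\prod_{i=1}^n(z-\alpha_{n,i})$, $n\in\mathbb{N}$, with all $\alpha_{n,i}\in\Sigma$, be such that $w_n$ divides $w_{n+1}$ for all $n$ (the interpolation table is newtonian)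 and such that the normalized zero counting measures (zeros counted with multiplicity) $\frac1n\sum_{i=1}^n\delta_{\alpha_{n,i}}$ converge weak* to $\mu$. Fix an integer $m\ge0$ and for $n\ge m$ let $\Pi_{n,m}=P/Q$ be the multipoint Padé approximant of $f$: the rational function determined by polynomials $P,Q$ with $\deg P\le n-m$, $\deg Q\le m$, $Q\not\equiv0$ and $(Qf-P)/w_{n+1}$ analytic on $V$. Suppose that $f$ has a value $f(z)\in\mathbb{C}$ at some single point $z\in\mathbb C\setminus\Sigma$ and that, for some $R\in(0,\infty]$, $$\limsup_{n\to\infty}|f(z)-\Pi_{n,m}(z)|^{1/n}\le\frac{\rho_\mu(\{z\})}{R}<1,$$ where $|f(z)-\Pi_{n,m}(z)|=\infty$ if $z$ is a pole of $\Pi_{n,m}$, and $\rho_\mu(\{z\})/\infty=0$. Then $R_{\mu,m}\ge R$, and $f$ admits meromorphic continuation with at most $m$ poles to $E_\mu(R)$. -/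

import Mathlib

open Filter Topology MeasureTheory Polynomial
open scoped ENNReal NNReal

noncomputable section

namespace MultipointPade

/-- The logarithmic potential `P(μ; z) = ∫ -log |z - ζ| dμ(ζ)`, with values in `[-∞, ∞]`: the
integral of the positive part minus the integral of the negative part, where `-log 0 = +∞`.
(For a finite measure with compact support the second integral is finite.) -/
def logPotential (μ : Measure ℂ) (z : ℂ) : EReal :=
  ((∫⁻ ζ, (-(ENNReal.log ‖z - ζ‖ₑ)).toENNReal ∂μ : ℝ≥0∞) : EReal)
    - ((∫⁻ ζ, (ENNReal.log ‖z - ζ‖ₑ).toENNReal ∂μ : ℝ≥0∞) : EReal)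

/-- `exp (-P(μ; z))`, which is `0` where the potential is `+∞`. -/
def expNegPotential (μ : Measure ℂ) (z : ℂ) : ℝ≥0∞ :=
  EReal.exp (-(logPotential μ z))

/-- `ρ_μ(K)`, the supremum of `exp (-P(μ; ·))` on `K`. -/
def rho (μ : Measure ℂ) (K : Set ℂ) : ℝ≥0∞ :=
  ⨆ z ∈ K, expNegPotential μ z

/-- `r₀`, the infimum of `exp (-P(μ; ·))` on the compact set `S`. -/
def rZero (μ : Measure ℂ) (S : Set ℂ) : ℝ≥0∞ :=
  ⨅ z ∈ S, expNegPotential μ z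

/-- `E_μ(r) = {z ∈ ℂ : exp (-P(μ; z)) < r}`; the value `r = ∞` is allowed. -/
def levelSet (μ : Measure ℂ) (r : ℝ≥0∞) : Set ℂ :=
  {z | expNegPotential μ z < r}

/-- The order of the pole of `F` at `x` (`0` if `F` has no pole at `x`). -/
def poleOrder (F : ℂ → ℂ) (x : ℂ) : ℕ :=
  (-(meromorphicOrderAt F x).untop₀).toNat

/-- `F` is meromorphic on `U` and has there at most `m` poles, counting multiplicities. -/
def MeromorphicWithAtMost (m : ℕ) (F : ℂ → ℂ) (U : Set ℂ) : Prop :=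
  MeromorphicOn F U ∧ ∀ T : Finset ℂ, (T : Set ℂ) ⊆ U → ∑ x ∈ T, poleOrder F x ≤ m

/-- `f`, analytic near the support of `μ`, admits meromorphic continuation with at most `m` poles
to the set `U`: some meromorphic function on `U` with at most `m` poles coincides with `f` near
every point of the support of `μ` that lies in `U`. -/
def HasMeromorphicContinuation (μ : Measure ℂ) (m : ℕ) (f : ℂ → ℂ) (U : Set ℂ) : Prop :=
  ∃ F : ℂ → ℂ, MeromorphicWithAtMost m F U ∧ ∀ x ∈ μ.support ∩ U, F =ᶠ[𝓝 x] f

/-- `R_{μ,m}`: the supremum of the numbers `r > r₀` such that `f` admits meromorphic continuation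
with at most `m` poles to `E_μ(r)`. The supremum is taken in `[r₀, ∞]`. -/
def meromorphyRadius (μ : Measure ℂ) (S : Set ℂ) (m : ℕ) (f : ℂ → ℂ) : ℝ≥0∞ :=
  rZero μ S ⊔ ⨆ (r : ℝ≥0) (_ : rZero μ S < r)
    (_ : HasMeromorphicContinuation μ m f (levelSet μ r)), (r : ℝ≥0∞)

/-- `w_n(z) = ∏_{i=1}^n (z - α_{n,i})`. -/
def nodePoly (α : (n : ℕ) → Fin n → ℂ) (n : ℕ) : ℂ[X] :=
  ∏ i : Fin n, (X - C (α n i))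

/-- The table of interpolation points is newtonian: `w_n` divides `w_{n+1}` for all `n`. -/
def IsNewtonian (α : (n : ℕ) → Fin n → ℂ) : Prop :=
  ∀ n, nodePoly α n ∣ nodePoly α (n + 1)

/-- The normalized zero counting measure of a polynomial; zeros count with multiplicity. -/
def zeroCountingMeasure (p : ℂ[X]) : Measure ℂ :=
  (p.natDegree : ℝ≥0∞)⁻¹ • (p.roots.map fun ξ => Measure.dirac ξ).sum

/-- Weak* convergence of measures on the plane, regarded as measures on the Riemann sphere: the
test functions are all continuous functions on the sphere. -/
def WeakStarTendsto (ν : ℕ → Measure ℂ) (μ : Measure ℂ) : Prop :=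
  ∀ φ : C(OnePoint ℂ, ℝ),
    Tendsto (fun n => ∫ x, φ (x : OnePoint ℂ) ∂(ν n)) atTop (𝓝 (∫ x, φ (x : OnePoint ℂ) ∂μ))

/-- `μ` is the asymptotic zero distribution of the polynomials `w_n` of the table `α`. -/
def IsAsymptoticDistribution (α : (n : ℕ) → Fin n → ℂ) (μ : Measure ℂ) : Prop :=
  WeakStarTendsto (fun n => zeroCountingMeasure (nodePoly α n)) μ

/-- `r` is the multipoint Padé approximant `Π_{n,m}` (`n ≥ m`) of the function `f`, analytic on
`V`: `r = P / Q` with `deg P ≤ n - m`, `deg Q ≤ m`, `Q ≠ 0` and `(Q f - P) / w_{n+1}` analytic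
on `V`. -/
def IsMultipointPade (f : ℂ → ℂ) (V : Set ℂ) (α : (n : ℕ) → Fin n → ℂ) (n m : ℕ)
    (r : RatFunc ℂ) : Prop :=
  ∃ P Q : ℂ[X], P.natDegree ≤ n - m ∧ Q.natDegree ≤ m ∧ Q ≠ 0 ∧
    (∃ g : ℂ → ℂ, DifferentiableOn ℂ g V ∧
      ∀ ζ ∈ V, Q.eval ζ * f ζ - P.eval ζ = (nodePoly α (n + 1)).eval ζ * g ζ) ∧
    r = algebraMap ℂ[X] (RatFunc ℂ) P / algebraMap ℂ[X] (RatFunc ℂ) Q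

/-- `|c - r(z)|`, where the rational function `r` is in lowest terms; the value is `∞` if `z` is a
pole of `r`. -/
def pointError (c : ℂ) (r : RatFunc ℂ) (z : ℂ) : ℝ≥0∞ :=
  if r.denom.eval z = 0 then ∞ else ‖c - r.num.eval z / r.denom.eval z‖ₑ

end MultipointPade

end

/-!
Write the approximants as `Π_n = P_n / Q_n`. Since the table is newtonian, `P_{n+1} Q_n - P_n Q_{n+1}`
is divisible by `w_{n+1}`, and as its degree is at most `n + 1`, it equals `A_n w_{n+1}` for a
constant `A_n` (`exists_cross_eq_C_mul_nodePoly`). This constant can be read off at the single point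
`z`: there `|w_n|^{1/n}` tends to `exp (-P(μ; z))`, because `z` has positive distance from the nodes
(`eventually_pow_le_norm_nodePoly`), so the hypothesis at `z` says that the upper limit of
`|A_n|^{1/n}` is at most `1 / R`. By the principle of descent (`eventually_norm_nodePoly_le`)
`|w_n|^{1/n}` is asymptotically at most some `r < R` near each point of `E_μ(R)`, whence
`P_{n+1} Q_n - P_n Q_{n+1}` is geometrically small there (`exists_geometric_cross`).

The denominators are normalized to products of `m` linear forms `a z - b` with `(a, b)` of norm `1`
(`linProd`). Such products form a compact family without the zero polynomial, so `Q_n` converges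
along a subsequence to some `Q ≠ 0` of degree at most `m`. Almost every circle about a point of
`E_μ(R)` stays so far from the zeros of the `Q_n` that the `Π_n` converge uniformly on it
(`exists_radius`, by Borel–Cantelli); along the subsequence, `P_n = Q_n Π_n` then converges uniformly
on the circle, and by the maximum principle inside it (`uniformCauchySeqOn_numerators`). The limit
`p` of the numerators is analytic on `E_μ(R)`, and `p / Q` has at most `m` poles.

Finally, `Q_n f - P_n` is divisible by `w_{n+1}`. Near a point of the support of `μ` the number of
zeros of `w_{n+1}` tends to infinity, and these functions are uniformly bounded along the
subsequence, so they tend to `0` by a Schwarz lemma (`norm_le_of_nodePoly_mul`,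
`tendsto_linearized_error`). Hence `Q f = p` there, and `p / Q` continues `f`.
-/

noncomputable section

namespace MultipointPade

/-! ### Node polynomials and their zero counting measures -/

lemma nodePoly_eval (α : (n : ℕ) → Fin n → ℂ) (n : ℕ) (y : ℂ) :
    (nodePoly α n).eval y = ∏ i, (y - α n i) := by
  simp [nodePoly, eval_prod]

lemma nodePoly_monic (α : (n : ℕ) → Fin n → ℂ) (n : ℕ) : (nodePoly α n).Monic :=
  monic_prod_X_sub_C _ _

lemma nodePoly_natDegree (α : (n : ℕ) → Fin n → ℂ) (n : ℕ) : (nodePoly α n).natDegree = n := by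
  simp [nodePoly, natDegree_finsetProd_X_sub_C_eq_card]

lemma nodePoly_roots (α : (n : ℕ) → Fin n → ℂ) (n : ℕ) :
    (nodePoly α n).roots = (Finset.univ : Finset (Fin n)).val.map (α n) := by
  have h : nodePoly α n = ((Finset.univ.val.map (α n)).map fun a => X - C a).prod := by
    simp [nodePoly, Finset.prod, Function.comp_def]
  rw [h, roots_multiset_prod_X_sub_C]

lemma integral_zeroCountingMeasure (α : (n : ℕ) → Fin n → ℂ) (n : ℕ) (φ : ℂ → ℝ) :
    ∫ x, φ x ∂(zeroCountingMeasure (nodePoly α n)) = (∑ i, φ (α n i)) / n := by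
  have h : (((Finset.univ : Finset (Fin n)).val.map (α n)).map
      fun ξ => (Measure.dirac ξ : Measure ℂ)).sum = ∑ i, Measure.dirac (α n i) := by
    simp [Finset.sum, Function.comp_def]
  rw [zeroCountingMeasure, nodePoly_roots, nodePoly_natDegree, h, integral_smul_measure,
    integral_finsetSum_measure]
  · simp [div_eq_inv_mul]
  · intro i _
    exact integrable_dirac (by simp)

variable {S : Set ℂ} {μ : Measure ℂ} {α : (n : ℕ) → Fin n → ℂ}

lemma integrable_of_continuous [IsFiniteMeasure μ] (hS : IsCompact S) (hμ : μ Sᶜ = 0) {φ : ℂ → ℝ}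
    (hφ : Continuous φ) : Integrable φ μ := by
  have h := hφ.continuousOn.integrableOn_compact (μ := μ) hS
  rwa [IntegrableOn, Measure.restrict_eq_self_of_ae_mem (show ∀ᵐ x ∂μ, x ∈ S from hμ)] at h

/-- As all nodes lie in a compact set, weak* convergence may be tested on any continuous function
on the plane: multiply it by a cutoff function to extend it to the sphere. -/
lemma tendsto_average (hS : IsCompact S) (hμ : μ Sᶜ = 0) (hα : ∀ n i, α n i ∈ S)
    (hμα : IsAsymptoticDistribution α μ) {φ : ℂ → ℝ} (hφ : Continuous φ) :
    Tendsto (fun n : ℕ => (∑ i, φ (α n i)) / n) atTop (𝓝 (∫ x, φ x ∂μ)) := by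
  obtain ⟨χ, hχ1, -, hχc, -⟩ := exists_continuous_one_zero_of_isCompact hS isClosed_empty
    (Set.disjoint_empty S)
  have hz : Tendsto (fun x => φ x * χ x) (coclosedCompact ℂ) (𝓝 0) := by
    rw [coclosedCompact_eq_cocompact]
    exact (hχc.mul_left (f := φ)).is_zero_at_infty
  have h := hμα (OnePoint.continuousMapMk ⟨fun x => φ x * χ x, hφ.mul χ.continuous⟩ 0 hz)
  have e1 : ∫ x, φ x ∂μ = ∫ x, φ x * χ x ∂μ := by
    refine integral_congr_ae ?_
    filter_upwards [show ∀ᵐ x ∂μ, x ∈ S from hμ] with x hx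
    simp [hχ1 hx]
  rw [e1]
  refine Tendsto.congr (fun n => ?_) h
  refine (integral_zeroCountingMeasure α n (fun x => φ x * χ x)).trans ?_
  congr 1
  refine Finset.sum_congr rfl fun i _ => ?_
  simp [hχ1 (hα n i)]

/-! ### Potentials and the growth of the node polynomials -/

/-- The logarithm of the distance to `x`, truncated from below at `-k`. -/
def truncLog (k : ℕ) (x ζ : ℂ) : ℝ := Real.log (max (Real.exp (-k)) ‖x - ζ‖)

lemma continuous_truncLog (k : ℕ) (x : ℂ) : Continuous (truncLog k x) := by
  unfold truncLog
  refine Continuous.log (by fun_prop) fun ζ => ?_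
  have := Real.exp_pos (-(k : ℝ))
  have := le_max_left (Real.exp (-k)) ‖x - ζ‖
  linarith

lemma ofReal_truncLog (k : ℕ) (x ζ : ℂ) :
    ENNReal.ofReal (truncLog k x ζ) = (ENNReal.log ‖x - ζ‖ₑ).toENNReal := by
  rw [← ofReal_norm, truncLog]
  have hk : Real.exp (-(k : ℝ)) ≤ 1 := by simp
  rcases le_or_gt ‖x - ζ‖ 1 with h | h
  · rw [ENNReal.ofReal_of_nonpos, EReal.toENNReal_of_nonpos]
    · rw [ENNReal.log_le_zero_iff, ENNReal.ofReal_le_one]; exact h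
    · exact Real.log_nonpos (le_max_of_le_left (Real.exp_pos _).le) (max_le hk h)
  · rw [max_eq_right (hk.trans h.le), ENNReal.log_ofReal_of_pos (by linarith)]
    rfl

lemma ofReal_neg_truncLog (k : ℕ) (x ζ : ℂ) :
    ENNReal.ofReal (-truncLog k x ζ) = min (-ENNReal.log ‖x - ζ‖ₑ).toENNReal k := by
  rw [← ofReal_norm, truncLog]
  rcases (norm_nonneg (x - ζ)).eq_or_lt with h | h
  · rw [← h, max_eq_left (Real.exp_pos _).le]
    simp
  · rw [ENNReal.log_ofReal_of_pos h, ← EReal.coe_neg, EReal.real_coe_toENNReal,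
      ← ENNReal.ofReal_natCast, ← ENNReal.ofReal_min]
    congr 1
    rcases le_total (Real.exp (-k)) ‖x - ζ‖ with h' | h'
    · rw [max_eq_right h', min_eq_left]
      rw [← Real.le_log_iff_exp_le h] at h'
      linarith
    · rw [max_eq_left h', min_eq_right]
      · simp
      rw [← Real.log_le_iff_le_exp h] at h'
      linarith

/-- The truncated potentials are finite, and their positive and negative parts are those of the
potential, the latter truncated. -/
lemma coe_integral_truncLog [IsFiniteMeasure μ] (hS : IsCompact S) (hμ : μ Sᶜ = 0) (k : ℕ)
    (x : ℂ) : ((∫ ζ, truncLog k x ζ ∂μ : ℝ) : EReal)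
      = ((∫⁻ ζ, (ENNReal.log ‖x - ζ‖ₑ).toENNReal ∂μ : ℝ≥0∞) : EReal)
        - ((∫⁻ ζ, min (-ENNReal.log ‖x - ζ‖ₑ).toENNReal k ∂μ : ℝ≥0∞) : EReal) := by
  have hi := integrable_of_continuous hS hμ (continuous_truncLog k x)
  rw [integral_eq_lintegral_pos_part_sub_lintegral_neg_part hi, EReal.coe_sub,
    EReal.coe_ennreal_toReal hi.lintegral_lt_top.ne,
    EReal.coe_ennreal_toReal (by simpa using hi.neg.lintegral_lt_top.ne)]
  simp_rw [ofReal_truncLog, ofReal_neg_truncLog]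

lemma lintegral_logPos_ne_top [IsFiniteMeasure μ] (hS : IsCompact S) (hμ : μ Sᶜ = 0) (x : ℂ) :
    ∫⁻ ζ, (ENNReal.log ‖x - ζ‖ₑ).toENNReal ∂μ ≠ ∞ := by
  have hi := integrable_of_continuous hS hμ (continuous_truncLog 0 x)
  simp_rw [← ofReal_truncLog 0]
  exact hi.lintegral_lt_top.ne

lemma neg_logPotential [IsFiniteMeasure μ] (hS : IsCompact S) (hμ : μ Sᶜ = 0) (x : ℂ) :
    -logPotential μ x = ((∫⁻ ζ, (ENNReal.log ‖x - ζ‖ₑ).toENNReal ∂μ : ℝ≥0∞) : EReal)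
      - ((∫⁻ ζ, (-ENNReal.log ‖x - ζ‖ₑ).toENNReal ∂μ : ℝ≥0∞) : EReal) := by
  have h := lintegral_logPos_ne_top hS hμ x
  rw [logPotential, EReal.neg_sub]
  · rw [add_comm, sub_eq_add_neg]
  · simp
  · right; simpa using h

/-- Off the support, the potential agrees with its truncations of high order. -/
lemma expNegPotential_eq_of_le [IsFiniteMeasure μ] (hS : IsCompact S) (hμ : μ Sᶜ = 0) {k : ℕ}
    {z : ℂ} (hk : ∀ ζ ∈ S, Real.exp (-k) ≤ ‖z - ζ‖) :
    expNegPotential μ z = ENNReal.ofReal (Real.exp (∫ ζ, truncLog k z ζ ∂μ)) := by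
  rw [expNegPotential, neg_logPotential hS hμ, ← EReal.exp_coe, coe_integral_truncLog hS hμ]
  congr 3
  refine lintegral_congr_ae ?_
  filter_upwards [show ∀ᵐ x ∂μ, x ∈ S from hμ] with ζ hζ
  have h0 : 0 < ‖z - ζ‖ := (Real.exp_pos _).trans_le (hk ζ hζ)
  rw [← ofReal_neg_truncLog, truncLog, max_eq_right (hk ζ hζ), ← ofReal_norm,
    ENNReal.log_ofReal_of_pos h0]
  rfl

/-- The truncated potentials decrease to the potential, by monotone convergence. -/
lemma tendsto_exp_integral_truncLog [IsFiniteMeasure μ] (hS : IsCompact S) (hμ : μ Sᶜ = 0)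
    (x : ℂ) : Tendsto (fun k : ℕ => ENNReal.ofReal (Real.exp (∫ ζ, truncLog k x ζ ∂μ))) atTop
      (𝓝 (expNegPotential μ x)) := by
  rw [expNegPotential, neg_logPotential hS hμ]
  simp_rw [← EReal.exp_coe, coe_integral_truncLog hS hμ]
  refine (ENNReal.continuous_exp.tendsto _).comp ?_
  have hm : Measurable fun ζ => (-ENNReal.log ‖x - ζ‖ₑ).toENNReal := by
    have : Measurable fun ζ => ENNReal.log ‖x - ζ‖ₑ :=
      ENNReal.measurable_log.comp (by fun_prop)
    exact measurable_ereal_toENNReal.comp (measurable_neg.comp this)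
  have h : Tendsto (fun k : ℕ => ∫⁻ ζ, min (-ENNReal.log ‖x - ζ‖ₑ).toENNReal k ∂μ) atTop
      (𝓝 (∫⁻ ζ, (-ENNReal.log ‖x - ζ‖ₑ).toENNReal ∂μ)) := by
    refine lintegral_tendsto_of_tendsto_of_monotone (fun k => (hm.min measurable_const).aemeasurable)
      (ae_of_all _ fun ζ i j hij => ?_) (ae_of_all _ fun ζ => ?_)
    · exact min_le_min le_rfl (by exact_mod_cast hij)
    · simpa using tendsto_const_nhds.min ENNReal.tendsto_nat_nhds_top
  have h' := (continuous_coe_ennreal_ereal.tendsto _).comp h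
  have hA := lintegral_logPos_ne_top hS hμ x
  generalize ∫⁻ ζ, (ENNReal.log ‖x - ζ‖ₑ).toENNReal ∂μ = A at hA ⊢
  generalize ∫⁻ ζ, (-ENNReal.log ‖x - ζ‖ₑ).toENNReal ∂μ = B at h' ⊢
  have hc : ContinuousAt (fun p : EReal × EReal => p.1 + p.2) ((A : EReal), -(B : EReal)) :=
    EReal.continuousAt_add (Or.inl (by simpa using hA)) (Or.inl (by simp))
  exact hc.tendsto.comp (tendsto_const_nhds.prodMk_nhds ((continuous_neg.tendsto _).comp h'))

lemma norm_nodePoly_eval (n : ℕ) (y : ℂ) :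
    ‖(nodePoly α n).eval y‖ = ∏ i, ‖y - α n i‖ := by
  rw [nodePoly_eval, norm_prod]

lemma exp_truncLog (k : ℕ) (x ζ : ℂ) :
    Real.exp (truncLog k x ζ) = max (Real.exp (-k)) ‖x - ζ‖ :=
  Real.exp_log (lt_max_of_lt_left (Real.exp_pos _))

/-- Principle of descent: near a point of `E_μ(R)`, the polynomials `w_n` grow at most like `r ^ n`
for some `r < R`. -/
lemma eventually_norm_nodePoly_le [IsFiniteMeasure μ] (hS : IsCompact S) (hμ : μ Sᶜ = 0)
    (hα : ∀ n i, α n i ∈ S) (hμα : IsAsymptoticDistribution α μ) {x : ℂ} {R : ℝ≥0∞}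
    (hx : expNegPotential μ x < R) :
    ∃ s > 0, ∃ r : ℝ, 0 < r ∧ ENNReal.ofReal r < R ∧
      ∀ᶠ n in atTop, ∀ y, ‖y - x‖ ≤ s → ‖(nodePoly α n).eval y‖ ≤ r ^ n := by
  obtain ⟨k, hk⟩ := ((tendsto_exp_integral_truncLog hS hμ x).eventually_lt_const hx).exists
  obtain ⟨r, hr1, hr2⟩ := ENNReal.lt_iff_exists_nnreal_btwn.1 hk
  have hr0 : Real.exp (∫ ζ, truncLog k x ζ ∂μ) < r := by
    rw [ENNReal.ofReal, ENNReal.coe_lt_coe] at hr1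
    exact (Real.le_coe_toNNReal _).trans_lt (by exact_mod_cast hr1)
  set I := ∫ ζ, truncLog k x ζ ∂μ
  have hrpos : (0 : ℝ) < r := (Real.exp_pos _).trans hr0
  -- `t` absorbs the factor lost on moving from `x` to a nearby point
  obtain ⟨t, ht0, ht1⟩ : ∃ t > 0, I + t < Real.log r := by
    have := (Real.lt_log_iff_exp_lt hrpos).2 hr0
    exact ⟨(Real.log r - I) / 2, by linarith, by linarith⟩
  refine ⟨t * Real.exp (-k), by positivity, r, hrpos, by simpa using hr2, ?_⟩
  have hav := (tendsto_average hS hμ hα hμα (continuous_truncLog k x)).eventually_lt_const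
    (show I < Real.log r - t by linarith)
  filter_upwards [hav, eventually_gt_atTop 0] with n hn hn0 y hy
  have hn0' : (0 : ℝ) < n := by exact_mod_cast hn0
  rw [norm_nodePoly_eval]
  have hle : ∀ i, ‖y - α n i‖ ≤ Real.exp (truncLog k x (α n i) + t) := by
    intro i
    rw [Real.exp_add, exp_truncLog]
    set M := max (Real.exp (-k)) ‖x - α n i‖
    have h1 : ‖y - α n i‖ ≤ ‖y - x‖ + ‖x - α n i‖ := norm_sub_le_norm_sub_add_norm_sub _ _ _
    have h2 : Real.exp (-k) ≤ M := le_max_left _ _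
    have h3 : ‖x - α n i‖ ≤ M := le_max_right _ _
    have h4 : 0 < M := (Real.exp_pos _).trans_le h2
    have h5 : t + 1 ≤ Real.exp t := Real.add_one_le_exp t
    calc ‖y - α n i‖ ≤ t * M + M := by
          have := mul_le_mul_of_nonneg_left h2 ht0.le
          linarith
      _ = M * (t + 1) := by ring
      _ ≤ M * Real.exp t := by gcongr
  calc ∏ i, ‖y - α n i‖ ≤ ∏ i, Real.exp (truncLog k x (α n i) + t) :=
        Finset.prod_le_prod (fun _ _ => norm_nonneg _) fun i _ => hle i
    _ = Real.exp (∑ i, truncLog k x (α n i) + n * t) := by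
        rw [← Real.exp_sum, Finset.sum_add_distrib]; simp
    _ ≤ Real.exp (n * Real.log r) := by
        rw [div_lt_iff₀ hn0'] at hn
        gcongr
        linarith
    _ = (r : ℝ) ^ n := by rw [Real.exp_nat_mul, Real.exp_log hrpos]

/-- Off a compact set that carries the nodes and `μ`, the `n`-th roots of `|w_n|` are asymptotically
no smaller than `exp (-P(μ; ·))`. -/
lemma eventually_pow_le_norm_nodePoly [IsFiniteMeasure μ] (hS : IsCompact S) (hμ : μ Sᶜ = 0)
    (hα : ∀ n i, α n i ∈ S) (hμα : IsAsymptoticDistribution α μ) {z : ℂ} (hz : z ∉ S) :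
    ∃ ρ : ℝ, 0 < ρ ∧ expNegPotential μ z = ENNReal.ofReal ρ ∧
      ∀ r > 0, r < ρ → ∀ᶠ n in atTop, r ^ n ≤ ‖(nodePoly α n).eval z‖ := by
  obtain ⟨d, hd, hdS⟩ := Metric.isOpen_iff.1 hS.isClosed.isOpen_compl z hz
  obtain ⟨k, hk⟩ := (((Real.tendsto_exp_neg_atTop_nhds_zero.comp
    tendsto_natCast_atTop_atTop).eventually_lt_const hd)).exists
  have hk' : ∀ ζ ∈ S, Real.exp (-k) ≤ ‖z - ζ‖ := by
    intro ζ hζ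
    by_contra! h
    have hmem : ζ ∈ Metric.ball z d := by
      rw [Metric.mem_ball, dist_comm, dist_eq_norm]
      exact h.trans hk
    exact hdS hmem hζ
  refine ⟨_, Real.exp_pos _, expNegPotential_eq_of_le hS hμ hk', fun r hr hrI => ?_⟩
  rw [← Real.log_lt_iff_lt_exp hr] at hrI
  have hav := (tendsto_average hS hμ hα hμα (continuous_truncLog k z)).eventually_const_lt hrI
  filter_upwards [hav, eventually_gt_atTop 0] with n hn hn0
  have hn0' : (0 : ℝ) < n := by exact_mod_cast hn0
  rw [norm_nodePoly_eval]
  calc r ^ n = Real.exp (n * Real.log r) := by rw [Real.exp_nat_mul, Real.exp_log hr]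
    _ ≤ Real.exp (∑ i, truncLog k z (α n i)) := by
        rw [lt_div_iff₀ hn0'] at hn
        gcongr
        linarith
    _ = ∏ i, ‖z - α n i‖ := by
        rw [Real.exp_sum]
        refine Finset.prod_congr rfl fun i _ => ?_
        rw [exp_truncLog, max_eq_right (hk' _ (hα n i))]

open Classical in
/-- The nodes accumulate, with multiplicity, at every point of the support of `μ`. -/
lemma tendsto_card_nodes [IsFiniteMeasure μ] (hS : IsCompact S) (hμ : μ Sᶜ = 0)
    (hα : ∀ n i, α n i ∈ S) (hμα : IsAsymptoticDistribution α μ) {x : ℂ} (hx : x ∈ μ.support)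
    {t : ℝ} (ht : 0 < t) :
    Tendsto (fun n => (Finset.univ.filter fun i => α n i ∈ Metric.ball x t).card) atTop atTop := by
  set φ : ℂ → ℝ := fun ζ => max 0 (1 - dist ζ x / t) with hφd
  have hφ : Continuous φ := by fun_prop
  have hφ0 : ∀ ζ, 0 ≤ φ ζ := fun ζ => le_max_left _ _
  have hI : 0 < ∫ ζ, φ ζ ∂μ := by
    rw [integral_pos_iff_support_of_nonneg hφ0 (integrable_of_continuous hS hμ hφ)]
    refine ((Measure.mem_support_iff_forall x).1 hx _ (Metric.ball_mem_nhds x ht)).trans_le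
      (measure_mono fun ζ hζ => ?_)
    have : dist ζ x / t < 1 := by rwa [div_lt_one ht]
    exact (lt_max_of_lt_right (by linarith)).ne'
  set I := ∫ ζ, φ ζ ∂μ
  have hav := (tendsto_average hS hμ hα hμα hφ).eventually_const_lt (half_lt_self hI)
  have hlin : Tendsto (fun n : ℕ => (n : ℝ) * (I / 2)) atTop atTop :=
    tendsto_natCast_atTop_atTop.atTop_mul_const (half_pos hI)
  rw [← tendsto_natCast_atTop_iff (R := ℝ)]
  refine tendsto_atTop_mono' _ ?_ hlin
  filter_upwards [hav, eventually_gt_atTop 0] with n hn hn0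
  have hn0' : (0 : ℝ) < n := by exact_mod_cast hn0
  rw [lt_div_iff₀ hn0'] at hn
  have hle : ∑ i, φ (α n i) ≤ ∑ i, if α n i ∈ Metric.ball x t then (1 : ℝ) else 0 := by
    refine Finset.sum_le_sum fun i _ => ?_
    split_ifs with h
    · exact max_le zero_le_one (by have := div_nonneg (dist_nonneg (x := α n i) (y := x)) ht.le
                                   linarith)
    · refine max_le le_rfl ?_
      rw [Metric.mem_ball, not_lt] at h
      have := (one_le_div ht).2 h
      linarith
  rw [Finset.sum_boole] at hle
  linarith

/-! ### Normalized denominators -/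

/-- The product of the linear forms `a z - b` over pairs `(a, b)`, that is, over points `[b : a]` of
the Riemann sphere. Up to a constant factor these are all nonzero polynomials of degree at most
`m`, a root at infinity accounting for each missing degree; with the pairs normalized to norm `1`
they form a compact family. -/
def linProd {m : ℕ} (v : Fin m → ℂ × ℂ) : ℂ[X] :=
  ∏ i, (C (v i).1 * X - C (v i).2)

lemma linProd_eval {m : ℕ} (v : Fin m → ℂ × ℂ) (y : ℂ) :
    (linProd v).eval y = ∏ i, ((v i).1 * y - (v i).2) := by
  simp [linProd, eval_prod]

lemma continuous_linProd_eval (m : ℕ) :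
    Continuous fun p : (Fin m → ℂ × ℂ) × ℂ => (linProd p.1).eval p.2 := by
  simp_rw [linProd_eval]
  fun_prop

lemma linProd_natDegree_le {m : ℕ} (v : Fin m → ℂ × ℂ) : (linProd v).natDegree ≤ m := by
  refine (natDegree_prod_le _ _).trans ?_
  have h : ∀ i, (C (v i).1 * X - C (v i).2).natDegree ≤ 1 := fun i => by
    simpa [sub_eq_add_neg] using natDegree_linear_le (a := (v i).1) (b := -(v i).2)
  simpa using Finset.sum_le_sum fun i (_ : i ∈ Finset.univ) => h i

lemma linProd_ne_zero {m : ℕ} {v : Fin m → ℂ × ℂ} (hv : ∀ i, ‖v i‖ = 1) : linProd v ≠ 0 := by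
  refine Finset.prod_ne_zero_iff.2 fun i _ h => ?_
  have h0 := congrArg (fun p => coeff p 0) h
  have h1 := congrArg (fun p => coeff p 1) h
  simp at h0 h1
  have : v i = 0 := Prod.ext (by simpa [coeff_C] using h1) h0
  simpa [this] using hv i

lemma norm_linProd_eval_le {m : ℕ} {v : Fin m → ℂ × ℂ} (hv : ∀ i, ‖v i‖ = 1) {ρ : ℝ} {y : ℂ}
    (hy : ‖y‖ ≤ ρ) : ‖(linProd v).eval y‖ ≤ (ρ + 1) ^ m := by
  rw [linProd_eval, norm_prod]
  calc ∏ i, ‖(v i).1 * y - (v i).2‖ ≤ ∏ _i : Fin m, (ρ + 1) := by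
        refine Finset.prod_le_prod (fun _ _ => norm_nonneg _) fun i _ => ?_
        have h1 : ‖(v i).1‖ ≤ 1 := (norm_fst_le _).trans (hv i).le
        have h2 : ‖(v i).2‖ ≤ 1 := (norm_snd_le _).trans (hv i).le
        refine (norm_sub_le _ _).trans ?_
        rw [norm_mul]
        have := mul_le_mul h1 hy (norm_nonneg _) zero_le_one
        linarith
    _ = (ρ + 1) ^ m := by simp

/-- On a circle about `x` whose radius stays away from the distances of `x` to the roots, a
normalized product of linear forms is bounded from below. -/
lemma pow_le_norm_linProd_eval {m : ℕ} {v : Fin m → ℂ × ℂ} (hv : ∀ i, ‖v i‖ = 1) {ρ ε : ℝ}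
    (hρ : 1 ≤ ρ) (hε0 : 0 ≤ ε) (hε : ε ≤ 1 / 2) {x y : ℂ} (hy : ‖y‖ ≤ ρ)
    (hfar : ∀ i, 2 * ρ * ε ≤ |‖y - x‖ - ‖(v i).2 / (v i).1 - x‖|) :
    ε ^ m ≤ ‖(linProd v).eval y‖ := by
  rw [linProd_eval, norm_prod]
  calc ε ^ m = ∏ _i : Fin m, ε := by simp
    _ ≤ _ := Finset.prod_le_prod (fun _ _ => hε0) fun i _ => ?_
  have hv' : max ‖(v i).1‖ ‖(v i).2‖ = 1 := hv i
  have hρ0 : 0 < ρ := by linarith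
  rcases le_or_gt (1 / (2 * ρ)) ‖(v i).1‖ with h | h
  · have ha : (v i).1 ≠ 0 := norm_pos_iff.1 (lt_of_lt_of_le (by positivity) h)
    have e : (v i).1 * y - (v i).2 = (v i).1 * ((y - x) - ((v i).2 / (v i).1 - x)) := by
      field_simp; ring
    rw [e, norm_mul]
    calc ε = 1 / (2 * ρ) * (2 * ρ * ε) := by field_simp
      _ ≤ _ := mul_le_mul h ((hfar i).trans (abs_norm_sub_norm_le _ _)) (by positivity)
          (norm_nonneg _)
  · -- the root is so remote that the constant term dominates
    have hlt : ‖(v i).1‖ < 1 := h.trans_le (by rw [div_le_one (by positivity)]; linarith)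
    have hb : ‖(v i).2‖ = 1 := by
      rcases max_choice ‖(v i).1‖ ‖(v i).2‖ with h' | h' <;> linarith
    have h1 : ‖(v i).1 * y‖ ≤ 1 / 2 := by
      rw [norm_mul]
      calc ‖(v i).1‖ * ‖y‖ ≤ 1 / (2 * ρ) * ρ := by gcongr
        _ = 1 / 2 := by field_simp
    have h2 := norm_sub_norm_le (v i).2 ((v i).1 * y)
    rw [norm_sub_rev] at h2
    linarith

lemma exists_eq_C_mul_linProd (m : ℕ) {Q : ℂ[X]} (hQ : Q ≠ 0) (hdeg : Q.natDegree ≤ m) :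
    ∃ c : ℂ, c ≠ 0 ∧ ∃ v : Fin m → ℂ × ℂ, (∀ i, ‖v i‖ = 1) ∧ Q = C c * linProd v := by
  induction m generalizing Q with
  | zero =>
    rw [Nat.le_zero, natDegree_eq_zero] at hdeg
    obtain ⟨c, rfl⟩ := hdeg
    exact ⟨c, by simpa using hQ, Fin.elim0, fun i => i.elim0, by simp [linProd]⟩
  | succ m ih =>
    rcases hdeg.lt_or_eq with h | h
    · obtain ⟨c, hc, v, hv, rfl⟩ := ih hQ (Nat.lt_succ_iff.1 h)
      refine ⟨c, hc, Fin.cons (0, -1) v, fun i => ?_, by simp [linProd, Fin.prod_univ_succ]⟩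
      refine Fin.cases ?_ (fun i => ?_) i
      · simp
      · simpa using hv i
    · obtain ⟨ξ, hξ⟩ := IsAlgClosed.exists_root Q
        (by rw [degree_eq_natDegree hQ, h]; exact_mod_cast m.succ_ne_zero)
      obtain ⟨Q', rfl⟩ := dvd_iff_isRoot.2 hξ
      have hQ' : Q' ≠ 0 := right_ne_zero_of_mul hQ
      rw [natDegree_mul (X_sub_C_ne_zero ξ) hQ', natDegree_X_sub_C] at h
      obtain ⟨c, hc, v, hv, rfl⟩ := ih hQ' (by omega)
      have hk : (‖((1 : ℂ), ξ)‖ : ℂ) ≠ 0 := by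
        rw [Complex.ofReal_ne_zero, norm_ne_zero_iff]
        simp
      set k : ℂ := (‖((1 : ℂ), ξ)‖ : ℂ) with hkd
      refine ⟨k * c, mul_ne_zero hk hc, Fin.cons (k⁻¹ • ((1 : ℂ), ξ)) v, fun i => ?_, ?_⟩
      · refine Fin.cases ?_ (fun i => ?_) i
        · rw [Fin.cons_zero, norm_smul, norm_inv, hkd, Complex.norm_real, norm_norm]
          exact inv_mul_cancel₀ (by simpa [hkd] using hk)
        · simpa using hv i
      · have e : (X - C ξ : ℂ[X]) = C k * (C k⁻¹ * X - C (k⁻¹ * ξ)) := by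
          rw [mul_sub, ← mul_assoc, ← C_mul, ← C_mul, ← mul_assoc, mul_inv_cancel₀ hk]
          simp
        simp only [linProd, Fin.prod_univ_succ, Fin.cons_zero, Fin.cons_succ, Prod.smul_mk,
          smul_eq_mul, mul_one]
        rw [e, C_mul (a := k) (b := c)]
        ring

/-! ### Interpolation identities -/

/-- A polynomial that is a continuous multiple of a product of linear factors near the roots is
divisible by this product. -/
lemma prod_X_sub_C_dvd {V : Set ℂ} (hV : IsOpen V) {g : ℂ → ℂ} (hg : ContinuousOn g V)
    {ι : Type*} (s : Finset ι) (a : ι → ℂ) (ha : ∀ i ∈ s, a i ∈ V) {p : ℂ[X]}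
    (h : ∀ ζ ∈ V, p.eval ζ = (∏ i ∈ s, (X - C (a i))).eval ζ * g ζ) :
    (∏ i ∈ s, (X - C (a i))) ∣ p := by
  classical
  induction s using Finset.induction_on generalizing p with
  | empty => simp
  | insert j s hj ih =>
    rw [Finset.prod_insert hj] at h ⊢
    have haj : a j ∈ V := ha j (Finset.mem_insert_self _ _)
    obtain ⟨p', rfl⟩ := dvd_iff_isRoot.2 (show p.IsRoot (a j) by rw [IsRoot, h _ haj]; simp)
    refine mul_dvd_mul_left _ (ih (fun i hi => ha i (Finset.mem_insert_of_mem hi)) ?_)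
    set q := ∏ i ∈ s, (X - C (a i))
    have hne : ∀ ζ ∈ V, ζ ≠ a j → p'.eval ζ = q.eval ζ * g ζ := by
      intro ζ hζ hζj
      have := h ζ hζ
      simp only [eval_mul, eval_sub, eval_X, eval_C, mul_assoc] at this
      exact mul_left_cancel₀ (sub_ne_zero.2 hζj) this
    intro ζ hζ
    rcases eq_or_ne ζ (a j) with rfl | hζj
    · -- at the removed root itself, by continuity
      have hgc : ContinuousAt g (a j) := hg.continuousAt (hV.mem_nhds hζ)
      have h1 : Tendsto (fun ζ => p'.eval ζ) (𝓝[≠] (a j)) (𝓝 (p'.eval (a j))) :=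
        p'.continuous.continuousAt.tendsto.mono_left nhdsWithin_le_nhds
      have h2 : Tendsto (fun ζ => q.eval ζ * g ζ) (𝓝[≠] (a j)) (𝓝 (q.eval (a j) * g (a j))) :=
        (q.continuous.continuousAt.mul hgc).tendsto.mono_left nhdsWithin_le_nhds
      refine tendsto_nhds_unique h1 (h2.congr' ?_)
      filter_upwards [self_mem_nhdsWithin, mem_nhdsWithin_of_mem_nhds (hV.mem_nhds hζ)]
        with y hy hyV
      exact (hne y hyV hy).symm
    · exact hne ζ hζ hζj

/-- Two successive approximants of a newtonian table differ by a constant multiple of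
`w_{n+1} / (Q_n Q_{n+1})`. -/
lemma exists_cross_eq_C_mul_nodePoly {V : Set ℂ} (hV : IsOpen V) {f : ℂ → ℂ}
    {α : (n : ℕ) → Fin n → ℂ} (hα : ∀ n i, α n i ∈ V) (hnewton : IsNewtonian α) {n m : ℕ}
    (hmn : m ≤ n) {P Q P' Q' : ℂ[X]} (hP : P.natDegree ≤ n - m) (hQ : Q.natDegree ≤ m)
    (hP' : P'.natDegree ≤ n + 1 - m) (hQ' : Q'.natDegree ≤ m) {g g' : ℂ → ℂ}
    (hg : DifferentiableOn ℂ g V) (hg' : DifferentiableOn ℂ g' V)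
    (h : ∀ ζ ∈ V, Q.eval ζ * f ζ - P.eval ζ = (nodePoly α (n + 1)).eval ζ * g ζ)
    (h' : ∀ ζ ∈ V, Q'.eval ζ * f ζ - P'.eval ζ = (nodePoly α (n + 2)).eval ζ * g' ζ) :
    ∃ A : ℂ, P' * Q - P * Q' = C A * nodePoly α (n + 1) := by
  obtain ⟨u, hu⟩ := hnewton (n + 1)
  have hdvd : nodePoly α (n + 1) ∣ P' * Q - P * Q' := by
    refine prod_X_sub_C_dvd hV (g := fun ζ => Q'.eval ζ * g ζ - Q.eval ζ * (u.eval ζ * g' ζ))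
      ?_ _ _ (fun i _ => hα _ i) fun ζ hζ => ?_
    · have := hg.continuousOn
      have := hg'.continuousOn
      have := Q.continuous
      have := Q'.continuous
      have := u.continuous
      fun_prop
    · change _ = (nodePoly α (n + 1)).eval ζ * _
      have h1 := h ζ hζ
      have h2 := h' ζ hζ
      rw [hu] at h2
      simp only [eval_mul, eval_sub] at h2 ⊢
      linear_combination (Q'.eval ζ) * h1 - (Q.eval ζ) * h2
  obtain ⟨B, hB⟩ := hdvd
  rcases eq_or_ne B 0 with rfl | hB0
  · exact ⟨0, by simpa using hB⟩
  have hdeg : (P' * Q - P * Q').natDegree ≤ n + 1 := by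
    refine (natDegree_sub_le _ _).trans (max_le ?_ ?_)
    · exact natDegree_mul_le.trans (by omega)
    · exact natDegree_mul_le.trans (by omega)
  rw [hB, (nodePoly_monic α (n + 1)).natDegree_mul' hB0, nodePoly_natDegree] at hdeg
  obtain ⟨A, rfl⟩ := natDegree_eq_zero.1 (show B.natDegree = 0 by omega)
  exact ⟨A, by rw [hB, mul_comm]⟩

/-- The pointwise error of `P / Q`, cleared of denominators. It does not matter whether `P` and `Q`
have a common zero at `z`. -/
lemma norm_le_of_pointError_lt {c z : ℂ} {P Q : ℂ[X]} (hQ : Q ≠ 0) {t : ℝ}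
    (h : pointError c (algebraMap ℂ[X] (RatFunc ℂ) P / algebraMap ℂ[X] (RatFunc ℂ) Q) z
      < ENNReal.ofReal t) :
    ‖c * Q.eval z - P.eval z‖ ≤ ‖Q.eval z‖ * t := by
  set r := algebraMap ℂ[X] (RatFunc ℂ) P / algebraMap ℂ[X] (RatFunc ℂ) Q with hr
  have hcross := congrArg (eval z) ((RatFunc.num_mul_eq_mul_denom_iff hQ).2 hr)
  simp only [eval_mul] at hcross
  rw [pointError] at h
  split_ifs at h with hd
  · simp at h
  · rw [← ofReal_norm, ENNReal.ofReal_lt_ofReal_iff_of_nonneg (norm_nonneg _)] at h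
    have e : c * Q.eval z - P.eval z = Q.eval z * (c - r.num.eval z / r.denom.eval z) := by
      field_simp
      linear_combination hcross
    rw [e, norm_mul]
    gcongr

/-! ### Convergence of the numerators -/

/-- Borel–Cantelli for radii: almost every radius stays away from a sequence of `m`-tuples of
points, up to summable distances. -/
lemma exists_radius {m : ℕ} (c : ℕ → Fin m → ℝ) {ε : ℕ → ℝ} (hε : Summable ε) {a b : ℝ}
    (hab : a < b) :
    ∃ t ∈ Set.Ioo a b, ∀ᶠ n in atTop, ∀ i, ε n ≤ |t - c n i| := by
  have hsum : ∑' n, volume (⋃ i, Metric.ball (c n i) (ε n)) ≠ ∞ := by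
    refine ne_top_of_le_ne_top ?_ (ENNReal.tsum_le_tsum
      (g := fun n => m * ENNReal.ofReal (2 * ε n)) fun n => ?_)
    · rw [ENNReal.tsum_mul_left]
      exact ENNReal.mul_ne_top (ENNReal.natCast_ne_top m) (hε.mul_left 2).tsum_ofReal_ne_top
    · refine (measure_iUnion_le _).trans ?_
      simp [Real.volume_ball]
  have hpos : volume (Set.Ioo a b) ≠ 0 := by simpa using hab
  obtain ⟨t, ht, hn⟩ := ((frequently_ae_mem_iff.2 hpos).and_eventually
    (ae_eventually_notMem hsum)).exists
  refine ⟨t, ht, hn.mono fun n hn i => ?_⟩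
  simp only [Set.mem_iUnion, Metric.mem_ball, Real.dist_eq, not_exists, not_lt] at hn
  exact hn i

/-- A uniformly geometric sequence converges uniformly. -/
lemma exists_tendstoUniformlyOn_of_geometric {K : Set ℂ} {F : ℕ → ℂ → ℂ} {C κ : ℝ} (hκ0 : 0 ≤ κ)
    (hκ : κ < 1) (h : ∀ᶠ n in atTop, ∀ y ∈ K, ‖F (n + 1) y - F n y‖ ≤ C * κ ^ n) :
    ∃ G, TendstoUniformlyOn F G atTop K := by
  obtain ⟨N, hN⟩ := eventually_atTop.1 h
  have hd : ∀ y ∈ K, ∀ n, dist (F (N + n) y) (F (N + (n + 1)) y) ≤ C * κ ^ N * κ ^ n := by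
    intro y hy n
    rw [dist_comm, dist_eq_norm, mul_assoc, ← pow_add]
    exact hN (N + n) (Nat.le_add_right _ _) y hy
  have hlim : ∀ y ∈ K, ∃ l, Tendsto (fun n => F (N + n) y) atTop (𝓝 l) := fun y hy =>
    cauchySeq_tendsto_of_complete (cauchySeq_of_le_geometric κ _ hκ (hd y hy))
  choose! G hG using hlim
  refine ⟨G, Metric.tendstoUniformlyOn_iff.2 fun ε hε => ?_⟩
  have hz : Tendsto (fun n : ℕ => C * κ ^ N * κ ^ n / (1 - κ)) atTop (𝓝 0) := by
    simpa using ((tendsto_pow_atTop_nhds_zero_of_lt_one hκ0 hκ).const_mul (C * κ ^ N)).div_const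
      (1 - κ)
  obtain ⟨M, hM⟩ := eventually_atTop.1 (hz.eventually_lt_const hε)
  filter_upwards [eventually_ge_atTop (N + M)] with n hn y hy
  obtain ⟨k, rfl⟩ := Nat.exists_eq_add_of_le ((Nat.le_add_right N M).trans hn)
  rw [dist_comm]
  exact (dist_le_of_le_geometric_of_tendsto κ _ hκ (hd y hy) (hG y hy) k).trans_lt
    (hM k (by omega))

lemma uniformCauchySeqOn_closedBall_of_sphere {F : ℕ → ℂ[X]} {x : ℂ} {t : ℝ} (ht : 0 < t)
    (h : UniformCauchySeqOn (fun n y => (F n).eval y) atTop (Metric.sphere x t)) :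
    UniformCauchySeqOn (fun n y => (F n).eval y) atTop (Metric.closedBall x t) := by
  rw [Metric.uniformCauchySeqOn_iff] at h ⊢
  intro ε hε
  obtain ⟨N, hN⟩ := h (ε / 2) (half_pos hε)
  refine ⟨N, fun i hi j hj y hy => ?_⟩
  rw [dist_eq_norm, ← eval_sub]
  refine lt_of_le_of_lt ?_ (half_lt_self hε)
  refine Complex.norm_le_of_forall_mem_frontier_norm_le (f := fun y => (F i - F j).eval y)
    Metric.isBounded_ball ((F i - F j).differentiable.diffContOnCl) (fun w hw => ?_)
    (by rwa [closure_ball x ht.ne'])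
  rw [frontier_ball x ht.ne'] at hw
  simpa [dist_eq_norm] using (hN i hi j hj w hw).le

/-- If consecutive fractions `P n / linProd (v n)` differ by a geometrically small amount after
clearing of denominators, then, along a subsequence where the denominators converge, the numerators
converge uniformly near `x`: on a suitable circle about `x` the denominators are bounded below by
a slowly decaying sequence, so the fractions converge uniformly there; the maximum principle carries
the convergence of the numerators to the disc. -/
lemma uniformCauchySeqOn_numerators {m : ℕ} {v : ℕ → Fin m → ℂ × ℂ} (hv : ∀ n i, ‖v n i‖ = 1)
    {P : ℕ → ℂ[X]} {x : ℂ} {s θ C : ℝ} (hs : 0 < s) (hθ0 : 0 < θ) (hθ : θ < 1)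
    (hcross : ∀ᶠ n in atTop, ∀ y, ‖y - x‖ ≤ s → ‖(P (n + 1)).eval y * (linProd (v n)).eval y
      - (P n).eval y * (linProd (v (n + 1))).eval y‖ ≤ C * θ ^ n)
    {φ : ℕ → ℕ} (hφ : StrictMono φ) {v₀ : Fin m → ℂ × ℂ}
    (hv₀ : Tendsto (v ∘ φ) atTop (𝓝 v₀)) :
    UniformCauchySeqOn (fun j y => (P (φ j)).eval y) atTop (Metric.closedBall x (s / 2)) := by
  -- `η ^ n` decays so slowly that dividing by `2 m` such factors preserves geometric smallness
  obtain ⟨η, hη1, hηθ, hη0⟩ : ∃ η : ℝ, η < 1 ∧ θ < η ^ (2 * m) ∧ 0 < η := by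
    have hc : Tendsto (fun η : ℝ => η ^ (2 * m)) (𝓝[<] 1) (𝓝 1) := by
      simpa using ((continuous_pow (M := ℝ) (2 * m)).tendsto 1).mono_left
        (nhdsWithin_le_nhds (s := Set.Iio 1))
    have h0 : ∀ᶠ η : ℝ in 𝓝[<] 1, 0 < η :=
      nhdsWithin_le_nhds (lt_mem_nhds one_pos)
    obtain ⟨η, h1, h2, h3⟩ :=
      ((show ∀ᶠ η : ℝ in 𝓝[<] 1, η < 1 from self_mem_nhdsWithin).and
        ((hc.eventually_const_lt hθ).and h0)).exists
    exact ⟨η, h1, h2, h3⟩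
  set ρ : ℝ := ‖x‖ + s + 1 with hρ
  have hρ1 : 1 ≤ ρ := by have := norm_nonneg x; linarith
  have hsum : Summable fun n : ℕ => 2 * ρ * η ^ n :=
    (summable_geometric_of_lt_one hη0.le hη1).mul_left _
  obtain ⟨t, ⟨ht1, ht2⟩, ht⟩ := exists_radius (fun n i => ‖(v n i).2 / (v n i).1 - x‖) hsum
    (half_lt_self hs)
  have ht0 : 0 < t := (half_pos hs).trans ht1
  have hyρ : ∀ y ∈ Metric.sphere x t, ‖y‖ ≤ ρ := by
    intro y hy
    rw [mem_sphere_iff_norm] at hy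
    have := norm_le_norm_add_norm_sub' y x
    linarith
  have hhalf := (tendsto_pow_atTop_nhds_zero_of_lt_one hη0.le hη1).eventually_le_const
    (show (0 : ℝ) < 1 / 2 by norm_num)
  have hlow : ∀ᶠ n in atTop, ∀ y ∈ Metric.sphere x t,
      (η ^ n) ^ m ≤ ‖(linProd (v n)).eval y‖ := by
    filter_upwards [ht, hhalf] with n hn hn2 y hy
    refine pow_le_norm_linProd_eval (hv n) hρ1 (by positivity) hn2 (x := x) (hyρ y hy) ?_
    rw [mem_sphere_iff_norm] at hy
    rw [hy]
    exact hn
  have hdiff : ∀ᶠ n in atTop, ∀ y ∈ Metric.sphere x t,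
      ‖(P (n + 1)).eval y / (linProd (v (n + 1))).eval y - (P n).eval y / (linProd (v n)).eval y‖
        ≤ C / η ^ m * (θ / η ^ (2 * m)) ^ n := by
    filter_upwards [hlow, (tendsto_add_atTop_nat 1).eventually hlow, hcross] with n h1 h2 h3 y hy
    have h1 := h1 y hy
    have h2 := h2 y hy
    have h3 := h3 y (by rw [mem_sphere_iff_norm] at hy; linarith)
    have p1 : 0 < (η ^ n) ^ m := by positivity
    have p2 : 0 < (η ^ (n + 1)) ^ m := by positivity
    have q1 := norm_pos_iff.1 (p1.trans_le h1)
    have q2 := norm_pos_iff.1 (p2.trans_le h2)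
    rw [div_sub_div _ _ q2 q1, norm_div, norm_mul]
    calc _ ≤ C * θ ^ n / ((η ^ (n + 1)) ^ m * (η ^ n) ^ m) := by
          refine div_le_div₀ ((norm_nonneg _).trans h3) ?_ (by positivity)
            (mul_le_mul h2 h1 p1.le (norm_nonneg _))
          rwa [mul_comm ((linProd (v (n + 1))).eval y)]
      _ = C / η ^ m * (θ / η ^ (2 * m)) ^ n := by
          rw [div_pow]
          field_simp
          ring
  obtain ⟨G, hG⟩ := exists_tendstoUniformlyOn_of_geometric
    (F := fun n y => (P n).eval y / (linProd (v n)).eval y) (by positivity)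
    ((div_lt_one (by positivity)).2 hηθ) hdiff
  have hK : IsCompact (Metric.sphere x t) := isCompact_sphere x t
  have hGc : ContinuousOn G (Metric.sphere x t) := by
    refine hG.continuousOn (Eventually.frequently ?_)
    filter_upwards [hlow] with n hn
    refine ContinuousOn.div (P n).continuous.continuousOn (linProd (v n)).continuous.continuousOn
      fun y hy => norm_pos_iff.1 (lt_of_lt_of_le (by positivity) (hn y hy))
  have hQ : TendstoUniformlyOn (fun j y => (linProd (v (φ j))).eval y)
      (fun y => (linProd v₀).eval y) atTop (Metric.sphere x t) := by
    rw [Metric.tendstoUniformlyOn_iff]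
    intro ε hε
    obtain ⟨W, hW, hWε⟩ := hK.mem_uniformity_of_prod (s := Set.univ)
      (f := fun (w : Fin m → ℂ × ℂ) y => (linProd w).eval y)
      (continuous_linProd_eval m).continuousOn (Set.mem_univ v₀) (Metric.dist_mem_uniformity hε)
    rw [nhdsWithin_univ] at hW
    filter_upwards [hv₀ hW] with j hj y hy
    rw [dist_comm]
    exact hWε _ hj y hy
  have hprod := (tendstoLocallyUniformlyOn_iff_tendstoUniformlyOn_of_compact hK).1
    (hQ.tendstoLocallyUniformlyOn.mul₀
      ((hG.seq_tendstoUniformlyOn φ hφ.tendsto_atTop).tendstoLocallyUniformlyOn)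
      (linProd v₀).continuous.continuousOn hGc)
  have hcau : UniformCauchySeqOn (fun j y => (P (φ j)).eval y) atTop (Metric.sphere x t) := by
    refine (hprod.congr ?_).uniformCauchySeqOn
    filter_upwards [hφ.tendsto_atTop.eventually hlow] with j hj y hy
    have : (linProd (v (φ j))).eval y ≠ 0 :=
      norm_pos_iff.1 (lt_of_lt_of_le (by positivity) (hj y hy))
    exact mul_div_cancel₀ _ this
  exact (uniformCauchySeqOn_closedBall_of_sphere ht0 hcau).mono
    (Metric.closedBall_subset_closedBall ht1.le)

/-! ### Poles of quotients by polynomials -/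

/-- A quotient of an analytic function by a polynomial has poles of order at most the multiplicities
of the roots of the polynomial. -/
lemma poleOrder_le_rootMultiplicity {F p : ℂ → ℂ} {Q : ℂ[X]} (hQ : Q ≠ 0) {x : ℂ}
    (hp : AnalyticAt ℂ p x) (h : ∀ᶠ y in 𝓝[≠] x, F y = p y / Q.eval y) :
    MeromorphicAt F x ∧ poleOrder F x ≤ Q.rootMultiplicity x := by
  set k := Q.rootMultiplicity x with hk
  obtain ⟨q, hq, hqx⟩ := Q.exists_eq_pow_rootMultiplicity_mul_and_not_dvd hQ x
  have hqx' : q.eval x ≠ 0 := fun h0 => hqx (dvd_iff_isRoot.2 h0)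
  have hqa : AnalyticAt ℂ (fun y => q.eval y) x := q.differentiable.analyticAt x
  have hu : AnalyticAt ℂ (fun y => p y / q.eval y) x := hp.div hqa hqx'
  have hl : MeromorphicAt (fun y : ℂ => (y - x) ^ (-(k : ℤ))) x := by fun_prop
  have hF : F =ᶠ[𝓝[≠] x] (fun y : ℂ => (y - x) ^ (-(k : ℤ))) * fun y => p y / q.eval y := by
    filter_upwards [h] with y hy
    have e := congrArg (eval y) hq
    simp only [eval_mul, eval_pow, eval_sub, eval_X, eval_C] at e
    rw [hy, e, Pi.mul_apply, zpow_neg, zpow_natCast, ← hk]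
    rw [div_mul_eq_div_div_swap, div_eq_inv_mul _ ((y - x) ^ k)]
  have hm := hl.mul hu.meromorphicAt
  refine ⟨hm.congr hF.symm, ?_⟩
  have hl' : meromorphicOrderAt (fun y : ℂ => (y - x) ^ (-(k : ℤ))) x
      = ((-(k : ℤ) : ℤ) : WithTop ℤ) := by
    rw [meromorphicOrderAt_eq_int_iff hl]
    exact ⟨fun _ => 1, analyticAt_const, one_ne_zero, by simp⟩
  rw [poleOrder, meromorphicOrderAt_congr hF, meromorphicOrderAt_mul hl hu.meromorphicAt, hl']
  have hn := hu.meromorphicOrderAt_nonneg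
  induction hj : meromorphicOrderAt (fun y => p y / q.eval y) x using WithTop.recTopCoe with
  | top => simp
  | coe j =>
    rw [hj] at hn
    have : 0 ≤ j := by exact_mod_cast hn
    rw [← WithTop.coe_add, WithTop.untop₀_coe]
    omega

lemma meromorphicWithAtMost_of_eq_div {F p : ℂ → ℂ} {Q : ℂ[X]} {U : Set ℂ} {m : ℕ} (hQ : Q ≠ 0)
    (hm : Q.natDegree ≤ m) (hp : ∀ x ∈ U, AnalyticAt ℂ p x)
    (h : ∀ y, Q.eval y ≠ 0 → F y = p y / Q.eval y) : MeromorphicWithAtMost m F U := by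
  have hloc : ∀ x ∈ U, MeromorphicAt F x ∧ poleOrder F x ≤ Q.rootMultiplicity x := by
    intro x hx
    refine poleOrder_le_rootMultiplicity hQ (hp x hx) ?_
    have hfin : ({y | Q.IsRoot y} \ {x}).Finite :=
      (Q.finite_setOfPred_isRoot hQ).subset Set.sdiff_subset
    filter_upwards [mem_nhdsWithin_of_mem_nhds (hfin.isClosed.isOpen_compl.mem_nhds (by simp)),
      self_mem_nhdsWithin] with y hy hyx
    exact h y fun h0 => hy ⟨h0, hyx⟩
  refine ⟨fun x hx => (hloc x hx).1, fun T hT => ?_⟩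
  calc ∑ x ∈ T, poleOrder F x ≤ ∑ x ∈ T, Q.roots.count x := by
        refine Finset.sum_le_sum fun x hx => ?_
        rw [count_roots]
        exact (hloc x (hT hx)).2
    _ ≤ Q.roots.card := by
        classical
        calc ∑ x ∈ T, Q.roots.count x ≤ ∑ x ∈ T ∪ Q.roots.toFinset, Q.roots.count x :=
              Finset.sum_le_sum_of_subset Finset.subset_union_left
          _ = Q.roots.card := Multiset.sum_count_eq_card fun x hx => by simp_all
    _ ≤ m := (card_roots' Q).trans hm

/-! ### Geometric convergence from the error at one point -/

/-- The one-point hypothesis bounds the coefficients of the telescoping series of the approximants,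
since `w_n` is not small at `z`; as the bound does not involve the point, it gives geometric
convergence wherever `exp (-P(μ; ·)) < R`. -/
lemma exists_geometric_cross {S : Set ℂ} (hS : IsCompact S) {μ : Measure ℂ} [IsFiniteMeasure μ]
    (hμ : μ Sᶜ = 0) {α : (n : ℕ) → Fin n → ℂ} (hα : ∀ n i, α n i ∈ S)
    (hμα : IsAsymptoticDistribution α μ) {m : ℕ} {v : ℕ → Fin m → ℂ × ℂ}
    (hv : ∀ n i, ‖v n i‖ = 1) {P : ℕ → ℂ[X]}
    (hcross : ∀ n, m ≤ n → ∃ A : ℂ, P (n + 1) * linProd (v n) - P n * linProd (v (n + 1))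
      = C A * nodePoly α (n + 1))
    {z c : ℂ} (hz : z ∉ S) {R : ℝ≥0∞}
    (hlimsup : limsup (fun n : ℕ => pointError c
      (algebraMap ℂ[X] (RatFunc ℂ) (P n) / algebraMap ℂ[X] (RatFunc ℂ) (linProd (v n))) z
        ^ (1 / (n : ℝ))) atTop ≤ rho μ {z} / R)
    {x : ℂ} (hx : expNegPotential μ x < R) :
    ∃ s > 0, ∃ θ > 0, θ < 1 ∧ ∃ B : ℝ, ∀ᶠ n in atTop, ∀ y, ‖y - x‖ ≤ s →
      ‖(P (n + 1)).eval y * (linProd (v n)).eval y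
        - (P n).eval y * (linProd (v (n + 1))).eval y‖ ≤ B * θ ^ n := by
  obtain ⟨s, hs, r, hr, hrR, hup⟩ := eventually_norm_nodePoly_le hS hμ hα hμα hx
  obtain ⟨ρ, hρ, hρz, hlow⟩ := eventually_pow_le_norm_nodePoly hS hμ hα hμα hz
  have hrho : rho μ {z} = ENNReal.ofReal ρ := by simp [rho, hρz]
  have hlt : limsup (fun n : ℕ => pointError c
      (algebraMap ℂ[X] (RatFunc ℂ) (P n) / algebraMap ℂ[X] (RatFunc ℂ) (linProd (v n))) z
        ^ (1 / (n : ℝ))) atTop < ENNReal.ofReal (ρ / r) := by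
    refine hlimsup.trans_lt ?_
    rw [hrho, ENNReal.ofReal_div_of_pos hr]
    exact ENNReal.div_lt_div_left (by simpa using hρ) (by simp) hrR
  -- numbers `q` and `r'` with `ρ / R < q`, `r' < ρ` and `q r < r'`
  obtain ⟨q, hq1, hq2⟩ := ENNReal.lt_iff_exists_nnreal_btwn.1 hlt
  have hqr : q * r < ρ := by
    rw [ENNReal.ofReal, ENNReal.coe_lt_coe, Real.lt_toNNReal_iff_coe_lt, lt_div_iff₀ hr] at hq2
    exact hq2
  have hq0 : 0 < (q : ℝ) := by
    exact_mod_cast pos_of_gt hq1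
  obtain ⟨r', hr'1, hr'2⟩ := exists_between hqr
  have hr'0 : 0 < r' := (mul_pos hq0 hr).trans hr'1
  have herr : ∀ᶠ n : ℕ in atTop, ‖c * (linProd (v n)).eval z - (P n).eval z‖
      ≤ ‖(linProd (v n)).eval z‖ * q ^ n := by
    filter_upwards [eventually_lt_of_limsup_lt hq1, eventually_gt_atTop 0] with n hn hn0
    refine norm_le_of_pointError_lt (linProd_ne_zero (hv n)) ?_
    have hn0' : (0 : ℝ) < n := by exact_mod_cast hn0
    rw [one_div, ENNReal.rpow_inv_lt_iff hn0', ENNReal.rpow_natCast] at hn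
    rwa [ENNReal.ofReal_pow q.coe_nonneg, ENNReal.ofReal_coe_nnreal]
  set M := (‖z‖ + 1) ^ m
  have hM : ∀ n, ‖(linProd (v n)).eval z‖ ≤ M := fun n => norm_linProd_eval_le (hv n) le_rfl
  have hM0 : 0 ≤ M := by positivity
  refine ⟨s, hs, q * r / r', by positivity, (div_lt_one hr'0).2 hr'1,
    M * M * (1 + q) * r / r', ?_⟩
  filter_upwards [herr, (tendsto_add_atTop_nat 1).eventually herr,
    (tendsto_add_atTop_nat 1).eventually hup,
    (tendsto_add_atTop_nat 1).eventually (hlow r' hr'0 hr'2), eventually_ge_atTop m]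
    with n h1 h2 h3 h4 hn y hy
  obtain ⟨A, hA⟩ := hcross n hn
  have heval : ∀ w : ℂ, (P (n + 1)).eval w * (linProd (v n)).eval w
      - (P n).eval w * (linProd (v (n + 1))).eval w = A * (nodePoly α (n + 1)).eval w := by
    intro w
    simpa using congrArg (eval w) hA
  have hAz : ‖A‖ * r' ^ (n + 1) ≤ M * M * (1 + q) * q ^ n := by
    calc ‖A‖ * r' ^ (n + 1) ≤ ‖A * (nodePoly α (n + 1)).eval z‖ := by
          rw [norm_mul]; gcongr
      _ = ‖(linProd (v (n + 1))).eval z * (c * (linProd (v n)).eval z - (P n).eval z)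
          - (linProd (v n)).eval z
            * (c * (linProd (v (n + 1))).eval z - (P (n + 1)).eval z)‖ := by
          rw [← heval]; congr 1; ring
      _ ≤ M * (M * q ^ n) + M * (M * q ^ (n + 1)) := by
          refine (norm_sub_le _ _).trans ?_
          rw [norm_mul, norm_mul]
          gcongr
          · exact hM _
          · exact h1.trans (by gcongr; exact hM _)
          · exact hM _
          · exact h2.trans (by gcongr; exact hM _)
      _ = M * M * (1 + q) * q ^ n := by ring
  rw [heval, norm_mul]
  calc ‖A‖ * ‖(nodePoly α (n + 1)).eval y‖
      ≤ M * M * (1 + q) * q ^ n / r' ^ (n + 1) * r ^ (n + 1) := by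
        gcongr
        · rwa [le_div_iff₀ (by positivity)]
        · exact h3 y hy
    _ = M * M * (1 + q) * r / r' * (q * r / r') ^ n := by
        rw [div_pow, mul_pow]; field_simp; ring

/-! ### Vanishing of the interpolation error on the support -/

open Classical in
/-- A Schwarz lemma: a function with `N` zeros among the nodes in a small disc is small there. -/
lemma norm_le_of_nodePoly_mul {V : Set ℂ} {H g : ℂ → ℂ} {α : (n : ℕ) → Fin n → ℂ} {n : ℕ}
    (hg : DifferentiableOn ℂ g V) {x : ℂ} {s M : ℝ} (hs : 0 < s)
    (hV : Metric.closedBall x s ⊆ V) (hH : ∀ ζ ∈ V, H ζ = (nodePoly α n).eval ζ * g ζ)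
    (hM : ∀ y ∈ Metric.sphere x s, ‖H y‖ ≤ M) {y : ℂ} (hy : y ∈ Metric.ball x (s / 4)) :
    ‖H y‖ ≤ M * (2 / 3) ^ (Finset.univ.filter fun i => α n i ∈ Metric.ball x (s / 4)).card := by
  set T := Finset.univ.filter fun i => α n i ∈ Metric.ball x (s / 4) with hT
  have hTmem : ∀ i ∈ T, dist (α n i) x < s / 4 := fun i hi => (Finset.mem_filter.1 hi).2
  set h : ℂ → ℂ := fun ζ => (∏ i ∈ Finset.univ.filter fun i => ¬ α n i ∈ Metric.ball x (s / 4),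
    (ζ - α n i)) * g ζ with hh
  have hHh : ∀ ζ ∈ V, H ζ = (∏ i ∈ T, (ζ - α n i)) * h ζ := by
    intro ζ hζ
    rw [hH ζ hζ, nodePoly_eval, hh, ← mul_assoc, hT, Finset.prod_filter_mul_prod_filter_not]
  have hhd : DifferentiableOn ℂ h (Metric.closedBall x s) := by
    refine DifferentiableOn.mul ?_ (hg.mono hV)
    fun_prop
  have hbd : ∀ w ∈ Metric.sphere x s, ‖h w‖ ≤ M / (3 * s / 4) ^ T.card := by
    intro w hw
    have hws : dist w x = s := hw
    rw [le_div_iff₀ (by positivity)]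
    refine le_trans ?_ (hM w hw)
    calc ‖h w‖ * (3 * s / 4) ^ T.card = (∏ _i ∈ T, (3 * s / 4)) * ‖h w‖ := by
          rw [Finset.prod_const, mul_comm]
      _ ≤ (∏ i ∈ T, ‖w - α n i‖) * ‖h w‖ := mul_le_mul_of_nonneg_right
          (Finset.prod_le_prod (fun _ _ => by positivity) fun i hi => ?_) (norm_nonneg (h w))
      _ = ‖H w‖ := by
          rw [hHh w (hV (Metric.sphere_subset_closedBall hw)), ← norm_prod]
          exact (norm_mul _ _).symm
    have h1 := hTmem i hi
    have h2 := dist_triangle w (α n i) x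
    rw [← dist_eq_norm]
    linarith
  have hys : y ∈ Metric.closedBall x s :=
    Metric.ball_subset_closedBall (Metric.ball_subset_ball (by linarith) hy)
  have hhy : ‖h y‖ ≤ M / (3 * s / 4) ^ T.card := by
    refine Complex.norm_le_of_forall_mem_frontier_norm_le (f := h)
      (Metric.isBounded_ball (x := x) (r := s)) ?_ ?_ (by rwa [closure_ball x hs.ne'])
    · refine DifferentiableOn.diffContOnCl ?_
      rwa [closure_ball x hs.ne']
    · rwa [frontier_ball x hs.ne']
  have hpy : ‖∏ i ∈ T, (y - α n i)‖ ≤ (s / 2) ^ T.card := by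
    rw [norm_prod, ← Finset.prod_const]
    gcongr with i hi
    have h1 := hTmem i hi
    have h2 := dist_triangle_right y (α n i) x
    have h3 : dist y x < s / 4 := hy
    rw [← dist_eq_norm]
    linarith
  rw [hHh y (hV hys), norm_mul]
  calc _ ≤ (s / 2) ^ T.card * (M / (3 * s / 4) ^ T.card) :=
        mul_le_mul hpy hhy (norm_nonneg _) (by positivity)
    _ = M * (2 / 3) ^ T.card := by
        rw [show s / 2 = 2 / 3 * (3 * s / 4) by ring, mul_pow]
        field_simp

/-- The linearized interpolation errors `Q_n f - P_n` tend to `0` near a point of the support of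
`μ`, because their zeros accumulate there. -/
lemma tendsto_linearized_error {S V : Set ℂ} (hS : IsCompact S) {μ : Measure ℂ}
    [IsFiniteMeasure μ] (hμ : μ Sᶜ = 0) {α : (n : ℕ) → Fin n → ℂ} (hα : ∀ n i, α n i ∈ S)
    (hμα : IsAsymptoticDistribution α μ) {f : ℂ → ℂ} (hf : DifferentiableOn ℂ f V) {m : ℕ}
    {v : ℕ → Fin m → ℂ × ℂ} (hv : ∀ n i, ‖v n i‖ = 1) {P : ℕ → ℂ[X]}
    (hint : ∀ n, m ≤ n → ∃ g : ℂ → ℂ, DifferentiableOn ℂ g V ∧ ∀ ζ ∈ V,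
      (linProd (v n)).eval ζ * f ζ - (P n).eval ζ = (nodePoly α (n + 1)).eval ζ * g ζ)
    {φ : ℕ → ℕ} (hφ : StrictMono φ) {x : ℂ} (hx : x ∈ μ.support) {s : ℝ} (hs : 0 < s)
    (hsV : Metric.closedBall x s ⊆ V)
    (hcau : UniformCauchySeqOn (fun j y => (P (φ j)).eval y) atTop (Metric.closedBall x s))
    {y : ℂ} (hy : y ∈ Metric.ball x (s / 4)) :
    Tendsto (fun j => (linProd (v (φ j))).eval y * f y - (P (φ j)).eval y) atTop (𝓝 0) := by
  classical
  have hK : IsCompact (Metric.closedBall x s) := isCompact_closedBall x s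
  obtain ⟨B, hB⟩ := hK.exists_bound_of_continuousOn (hf.continuousOn.mono hsV)
  obtain ⟨N, hN⟩ := Metric.uniformCauchySeqOn_iff.1 hcau 1 one_pos
  obtain ⟨D, hD⟩ := hK.exists_bound_of_continuousOn (P (φ N)).continuous.continuousOn
  set ρ : ℝ := ‖x‖ + s
  have hB0 : 0 ≤ B := (norm_nonneg _).trans (hB x (Metric.mem_closedBall_self hs.le))
  have hbound : ∀ j ≥ N, ∀ w ∈ Metric.closedBall x s,
      ‖(linProd (v (φ j))).eval w * f w - (P (φ j)).eval w‖ ≤ (ρ + 1) ^ m * B + (D + 1) := by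
    intro j hj w hw
    have hwρ : ‖w‖ ≤ ρ := by
      rw [mem_closedBall_iff_norm] at hw
      have := norm_le_norm_add_norm_sub' w x
      linarith
    have h1 := hN j hj N le_rfl w hw
    have h2 := hD w hw
    have h3 : ‖(P (φ j)).eval w‖ ≤ D + 1 := by
      rw [dist_eq_norm] at h1
      have := norm_le_norm_add_norm_sub' ((P (φ j)).eval w) ((P (φ N)).eval w)
      linarith
    refine (norm_sub_le _ _).trans (add_le_add ?_ h3)
    rw [norm_mul]
    exact mul_le_mul (norm_linProd_eval_le (hv _) hwρ) (hB w hw) (norm_nonneg _)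
      (pow_nonneg (by positivity) _)
  have hcard := (tendsto_card_nodes hS hμ hα hμα hx (show 0 < s / 4 by linarith)).comp
    ((tendsto_add_atTop_nat 1).comp hφ.tendsto_atTop)
  have hz := ((tendsto_pow_atTop_nhds_zero_of_lt_one (show (0 : ℝ) ≤ 2 / 3 by norm_num)
    (by norm_num)).comp hcard).const_mul ((ρ + 1) ^ m * B + (D + 1))
  rw [mul_zero] at hz
  refine squeeze_zero_norm' ?_ hz
  filter_upwards [eventually_ge_atTop N, hφ.tendsto_atTop.eventually_ge_atTop m] with j hj hjm
  obtain ⟨g, hg, hgeq⟩ := hint (φ j) hjm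
  exact norm_le_of_nodePoly_mul
    (H := fun w => (linProd (v (φ j))).eval w * f w - (P (φ j)).eval w) hg hs hsV hgeq
    (fun w hw => hbound j hj w (Metric.sphere_subset_closedBall hw)) hy

/-! ### Meromorphic continuation -/

lemma HasMeromorphicContinuation.mono {μ : Measure ℂ} {m : ℕ} {f : ℂ → ℂ} {U U' : Set ℂ}
    (h : HasMeromorphicContinuation μ m f U) (hU : U' ⊆ U) :
    HasMeromorphicContinuation μ m f U' := by
  obtain ⟨F, ⟨hF1, hF2⟩, hF⟩ := h
  exact ⟨F, ⟨fun x hx => hF1 x (hU hx), fun T hT => hF2 T (hT.trans hU)⟩,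
    fun x hx => hF x ⟨hx.1, hU hx.2⟩⟩

lemma le_meromorphyRadius {μ : Measure ℂ} {S : Set ℂ} {m : ℕ} {f : ℂ → ℂ} {R : ℝ≥0∞}
    (h : HasMeromorphicContinuation μ m f (levelSet μ R)) : R ≤ meromorphyRadius μ S m f := by
  refine le_of_forall_lt fun a ha => ?_
  rcases lt_or_ge a (rZero μ S) with h0 | h0
  · exact h0.trans_le le_sup_left
  · obtain ⟨r, hr1, hr2⟩ := ENNReal.lt_iff_exists_nnreal_btwn.1 ha
    refine hr1.trans_le (le_trans ?_ le_sup_right)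
    exact le_iSup_of_le r (le_iSup_of_le (h0.trans_lt hr1)
      (le_iSup_of_le (h.mono fun y hy => lt_trans hy hr2) le_rfl))

end MultipointPade

end

open MultipointPade in
theorem mainTheorem4
    (S : Set ℂ) (hS : IsCompact S) (hSc : IsConnected Sᶜ)
    (μ : Measure ℂ) [IsProbabilityMeasure μ] (hμ : μ Sᶜ = 0)
    (V : Set ℂ) (hV : IsOpen V) (hSV : S ⊆ V)
    (f : ℂ → ℂ) (hf : DifferentiableOn ℂ f V)
    (α : (n : ℕ) → Fin n → ℂ) (hα : ∀ n i, α n i ∈ S)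
    (hμα : MultipointPade.IsAsymptoticDistribution α μ)
    (hnewton : MultipointPade.IsNewtonian α)
    (m : ℕ) (Pade : ℕ → RatFunc ℂ)
    (hPade : ∀ n, m ≤ n → MultipointPade.IsMultipointPade f V α n m (Pade n))
    (z : ℂ) (hz : z ∉ S) (R : ℝ≥0∞)
    (hlimsup : limsup
        (fun n : ℕ => MultipointPade.pointError (f z) (Pade n) z ^ (1 / (n : ℝ))) atTop
      ≤ MultipointPade.rho μ {z} / R)
    (hlt : MultipointPade.rho μ {z} / R < 1) :
    R ≤ MultipointPade.meromorphyRadius μ S m f ∧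
      MultipointPade.HasMeromorphicContinuation μ m f (MultipointPade.levelSet μ R) := by
  suffices h : HasMeromorphicContinuation μ m f (levelSet μ R) from ⟨le_meromorphyRadius h, h⟩
  -- normalize the denominators to products of linear forms
  have hdata : ∀ n, ∃ (v : Fin m → ℂ × ℂ) (P : ℂ[X]), (∀ i, ‖v i‖ = 1) ∧ (m ≤ n →
      P.natDegree ≤ n - m ∧ (∃ g : ℂ → ℂ, DifferentiableOn ℂ g V ∧ ∀ ζ ∈ V,
        (linProd v).eval ζ * f ζ - P.eval ζ = (nodePoly α (n + 1)).eval ζ * g ζ) ∧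
      Pade n = algebraMap ℂ[X] (RatFunc ℂ) P / algebraMap ℂ[X] (RatFunc ℂ) (linProd v)) := by
    intro n
    by_cases hn : m ≤ n
    · obtain ⟨P, Q, hP, hQ, hQ0, ⟨g, hg, hgeq⟩, hr⟩ := hPade n hn
      obtain ⟨c, hc, v, hv, rfl⟩ := exists_eq_C_mul_linProd m hQ0 hQ
      have hC : (C c⁻¹ : ℂ[X]) * C c = 1 := by rw [← C_mul, inv_mul_cancel₀ hc, C_1]
      refine ⟨v, C c⁻¹ * P, hv, fun _ => ⟨(natDegree_C_mul_le _ _).trans hP,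
        ⟨fun ζ => c⁻¹ * g ζ, hg.const_mul _, fun ζ hζ => ?_⟩, ?_⟩⟩
      · have := hgeq ζ hζ
        simp only [eval_mul, eval_C] at this ⊢
        field_simp
        linear_combination this
      · have hC' : algebraMap ℂ[X] (RatFunc ℂ) (C c⁻¹) ≠ 0 := by
          simpa using hc
        rw [hr, ← mul_div_mul_left _ _ hC', ← map_mul, ← map_mul, ← mul_assoc, hC, one_mul]
    · exact ⟨fun _ => (1, 1), 0, fun _ => by simp, fun h => absurd h hn⟩
  choose v P hv hdata using hdata
  have hcross : ∀ n, m ≤ n → ∃ A : ℂ, P (n + 1) * linProd (v n) - P n * linProd (v (n + 1))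
      = C A * nodePoly α (n + 1) := by
    intro n hn
    obtain ⟨hP, ⟨g, hg, hgeq⟩, -⟩ := hdata n hn
    obtain ⟨hP', ⟨g', hg', hgeq'⟩, -⟩ := hdata (n + 1) (by omega)
    exact exists_cross_eq_C_mul_nodePoly hV (fun n i => hSV (hα n i)) hnewton hn hP
      (linProd_natDegree_le _) hP' (linProd_natDegree_le _) hg hg' hgeq hgeq'
  have hlimsup' : limsup (fun n : ℕ => pointError (f z)
      (algebraMap ℂ[X] (RatFunc ℂ) (P n) / algebraMap ℂ[X] (RatFunc ℂ) (linProd (v n))) z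
        ^ (1 / (n : ℝ))) atTop ≤ rho μ {z} / R := by
    refine (limsup_congr ?_).trans_le hlimsup
    filter_upwards [eventually_ge_atTop m] with n hn
    rw [(hdata n hn).2.2]
  -- a subsequence along which the denominators converge
  obtain ⟨v₀, hv₀, φ, hφ, hlim⟩ := (isCompact_univ_pi fun _ : Fin m =>
    isCompact_sphere (0 : ℂ × ℂ) 1).tendsto_subseq (x := v) fun n i _ => by simpa using hv n i
  have hv₀' : ∀ i, ‖v₀ i‖ = 1 := fun i => by simpa using hv₀ i (Set.mem_univ i)
  have hQ₀ : linProd v₀ ≠ 0 := linProd_ne_zero hv₀'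
  have hcau : ∀ x ∈ levelSet μ R, ∃ s > 0,
      UniformCauchySeqOn (fun j y => (P (φ j)).eval y) atTop (Metric.closedBall x s) := by
    intro x hx
    obtain ⟨s, hs, θ, hθ0, hθ, B, hB⟩ :=
      exists_geometric_cross hS hμ hα hμα hv hcross hz hlimsup' hx
    exact ⟨s / 2, half_pos hs, uniformCauchySeqOn_numerators hv hs hθ0 hθ hB hφ hlim⟩
  set p : ℂ → ℂ := fun y => limUnder atTop fun j => (P (φ j)).eval y with hp
  have hplim : ∀ {x : ℂ} {s : ℝ},
      UniformCauchySeqOn (fun j y => (P (φ j)).eval y) atTop (Metric.closedBall x s) →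
      ∀ y ∈ Metric.closedBall x s, Tendsto (fun j => (P (φ j)).eval y) atTop (𝓝 (p y)) :=
    fun h y hy => (h.cauchySeq hy).tendsto_limUnder
  have hpan : ∀ x ∈ levelSet μ R, AnalyticAt ℂ p x := by
    intro x hx
    obtain ⟨s, hs, h⟩ := hcau x hx
    have hu := (h.tendstoUniformlyOn_of_tendsto (hplim h)).mono Metric.ball_subset_closedBall
    exact (hu.tendstoLocallyUniformlyOn.differentiableOn
      (.of_forall fun j => (P (φ j)).differentiable.differentiableOn)
      Metric.isOpen_ball).analyticAt (Metric.ball_mem_nhds x hs)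
  classical
  -- the value `f y` at the zeros of the denominator makes the continuation agree with `f` there too
  refine ⟨fun y => if (linProd v₀).eval y = 0 then f y else p y / (linProd v₀).eval y,
    meromorphicWithAtMost_of_eq_div hQ₀ (linProd_natDegree_le v₀) hpan
      fun y hy => if_neg hy, fun x ⟨hxμ, hx⟩ => ?_⟩
  have hxS : x ∈ S := by
    by_contra hxS
    exact ((Measure.mem_support_iff_forall x).1 hxμ _
      (hS.isClosed.isOpen_compl.mem_nhds hxS)).ne' hμ
  obtain ⟨s₁, hs₁, h₁⟩ := hcau x hx
  obtain ⟨s₂, hs₂, h₂⟩ := Metric.nhds_basis_closedBall.mem_iff.1 (hV.mem_nhds (hSV hxS))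
  have hs : 0 < min s₁ s₂ := lt_min hs₁ hs₂
  have hsub : Metric.closedBall x (min s₁ s₂) ⊆ Metric.closedBall x s₁ :=
    Metric.closedBall_subset_closedBall (min_le_left _ _)
  filter_upwards [Metric.ball_mem_nhds x (show 0 < min s₁ s₂ / 4 by linarith)] with y hy
  have h0 := tendsto_linearized_error hS hμ hα hμα hf hv (fun n hn => (hdata n hn).2.1) hφ hxμ hs
    ((Metric.closedBall_subset_closedBall (min_le_right _ _)).trans h₂) (h₁.mono hsub) hy
  have hy' : y ∈ Metric.closedBall x s₁ :=
    hsub (Metric.ball_subset_closedBall (Metric.ball_subset_ball (by linarith) hy))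
  have hQy : Tendsto (fun j => (linProd (v (φ j))).eval y) atTop (𝓝 ((linProd v₀).eval y)) :=
    ((continuous_linProd_eval m).comp (by fun_prop : Continuous fun w => (w, y))).continuousAt
      |>.tendsto.comp hlim
  have hfp := tendsto_nhds_unique h0 ((hQy.mul_const (f y)).sub (hplim h₁ y hy'))
  split_ifs with hQ
  · rfl
  · rw [div_eq_iff hQ]
    linear_combination hfp
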